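/- All lattices are finite and nonempty, with least element $\hat 0$ and greatest element $\hat 1$. A lattice is graded if all of its maximal chains have the same length. For a subset $\mathrm G$ of a lattice $\mathcal L$ and $F\in\mathcal L$, let $\max \mathrm G_{\leqslant F}$ denote the set of maximal elements of $\{G\in \mathrm G : G\leqslant F\}$. A subset $\mathrm G\subseteq \mathcal L\setminus\{\hat 0\}$ is a building set of $\mathcal L$ if for every $F\in\mathcal L$ the join map \[ \prod_{G\in\max \mathrm G_{\leqslant F}}[\hat 0,G]\longrightarrow[\hat 0,F],\qquad (H_G)_G\longmapsto\bigvee_G H_G, \] is an isomorphism of posets. A subset $S\subseteq \mathrm G$ is nested if for every antichain $A\subseteq S$ of cardinality at least $2$ the join $\bigvee A$ does not belong to $\mathrm G$. The nested set complex $\mathbf N(\mathcal L,\mathrm G)$ is the simplicial complex whose faces are the nested sets that contain no maximal element of $\mathrm G$. An element of $\mathcal L$ is join-irreducible if it is not a join of strictly smaller elements (so $\hat 0$, the empty join, is not join-irreducible); let $\mathcal I(\mathcal L)$ be the set of join-irreducible elements. A map $\omega:\mathcal I(\mathcal L)\to\mathbb Z_{>0}$ is admissible if the labeling \[ \lambda_\omega(F_1\lessdot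 F_2)=\min\{\omega(I) : I\in\mathcal I(\mathcal L),\ F_1\vee I=F_2\} \] of the covering relations of $\mathcal L$ is an R-labeling, i.e. if for all $F_1\leqslant F_2$ in $\mathcal L$ there is a unique saturated chain from $F_1$ to $F_2$ whose labels are weakly increasing. A simplicial complex $\Delta$ is vertex decomposable if it is a simplex (possibly the complex $\{\emptyset\}$) or, inductively, it is pure and has a vertex $v$ such that every facet of the deletion $\Delta\setminus\{v\}$ is a facet of $\Delta$, and both $\Delta\setminus\{v\}$ and the link $\mathrm{lk}_\Delta(v)$ are vertex decomposable. Theorem. Let $\mathcal L$ be a graded lattice and let $\mathrm G$ be any building set of $\mathcal L$. If $\mathcal L$ admits an injective admissible map, then the nested set complex $\mathbf N(\mathcal L,\mathrm G)$ is vertex decomposable. -/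

import Mathlib

/-! ### Simplicial complexes and vertex decomposability

Mathlib's `PreAbstractSimplicialComplex` records the nonempty faces only; the empty face is always
understood to be present, so the complex without recorded faces is the `(-1)`-dimensional simplex
`{∅}`. -/

namespace PreAbstractSimplicialComplex

/-- A facet is a face that is maximal under inclusion. -/
def IsFacet {α : Type*} (K : PreAbstractSimplicialComplex α) (s : Finset α) : Prop :=
  Maximal (fun t => t ∈ K.faces) s

/-- A complex is pure if all of its facets have the same cardinality. -/
def IsPure {α : Type*} (K : PreAbstractSimplicialComplex α) : Prop :=
  ∀ s t : Finset α, K.IsFacet s → K.IsFacet t → s.card = t.card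

/-- A complex is a simplex if its faces are all the subsets of some finite set (possibly empty). -/
def IsSimplex {α : Type*} (K : PreAbstractSimplicialComplex α) : Prop :=
  ∃ s : Finset α, ∀ t : Finset α, t ∈ K.faces ↔ t.Nonempty ∧ t ⊆ s

/-- The deletion of `v`: all faces not containing `v`. -/
def deletion {α : Type*} (K : PreAbstractSimplicialComplex α) (v : α) :
    PreAbstractSimplicialComplex α where
  faces := {t | t ∈ K.faces ∧ v ∉ t}
  isRelLowerSet_faces := fun _ hs =>
    ⟨(K.isRelLowerSet_faces hs.1).1, fun _ hts ht =>
      ⟨(K.isRelLowerSet_faces hs.1).2 hts ht, fun hv => hs.2 (hts hv)⟩⟩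

/-- The link of `v`: all faces `t` not containing `v` such that `t ∪ {v}` is a face. -/
def link {α : Type*} (K : PreAbstractSimplicialComplex α) (v : α) :
    PreAbstractSimplicialComplex α where
  faces := {t | t.Nonempty ∧ ∃ h : v ∉ t, Finset.cons v t h ∈ K.faces}
  isRelLowerSet_faces := fun _ hs =>
    ⟨hs.1, fun _ hts ht => ⟨ht, fun hv => hs.2.1 (hts hv),
      (K.isRelLowerSet_faces hs.2.2).2 (Finset.cons_subset_cons.2 hts) (Finset.cons_nonempty _)⟩⟩

/-- A complex is vertex decomposable if it is a simplex or, inductively, it is pure and has a vertex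
`v` such that every facet of the deletion of `v` is a facet of the complex, and both the deletion
and the link of `v` are vertex decomposable. -/
inductive VertexDecomposable {α : Type*} : PreAbstractSimplicialComplex α → Prop
  | simplex (K : PreAbstractSimplicialComplex α) (hK : K.IsSimplex) : VertexDecomposable K
  | step (K : PreAbstractSimplicialComplex α) (v : α) (hv : {v} ∈ K.faces) (hpure : K.IsPure)
      (hshed : ∀ s : Finset α, (K.deletion v).IsFacet s → K.IsFacet s)
      (hdel : VertexDecomposable (K.deletion v))
      (hlink : VertexDecomposable (K.link v)) : VertexDecomposable K

end PreAbstractSimplicialComplex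

namespace NestedSets

/-! ### Building sets and nested set complexes -/

/-- The maximal elements of `G_{≤ F}`, i.e. the `G`-factors of `F`. -/
def factors {L : Type*} [PartialOrder L] (G : Set L) (F : L) : Set L :=
  {g | Maximal (fun x => x ∈ G ∧ x ≤ F) g}

/-- `G ⊆ L \ {⊥}` is a building set if, for every `F`, the join map from the product of the intervals
`[⊥, g]`, over the maximal elements `g` of `G_{≤ F}`, to `[⊥, F]` is an isomorphism of posets. -/
def IsBuildingSet {L : Type*} [Lattice L] [BoundedOrder L] (G : Set L) : Prop :=
  ⊥ ∉ G ∧ ∀ F : L, ∃ ψ : ((g : factors G F) → Set.Iic (g : L)) ≃o Set.Iic F,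
    ∀ H : (g : factors G F) → Set.Iic (g : L),
      IsLUB (Set.range fun g => (H g : L)) (ψ H : L)

/-- `S ⊆ G` is nested if no antichain in `S` with at least two elements has its join in `G`. -/
def IsNested {L : Type*} [Lattice L] [BoundedOrder L] (G : Set L) (S : Finset L) : Prop :=
  (S : Set L) ⊆ G ∧
    ∀ A : Finset L, A ⊆ S → IsAntichain (· ≤ ·) (A : Set L) → 2 ≤ A.card → A.sup id ∉ G

/-- The nested set complex `N(L, G)`: nested sets without maximal elements of `G`. -/
def nestedSetComplex {L : Type*} [Lattice L] [BoundedOrder L] (G : Set L) :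
    PreAbstractSimplicialComplex L where
  faces := {S | S.Nonempty ∧ IsNested G S ∧ ∀ g ∈ S, ¬ Maximal (· ∈ G) g}
  isRelLowerSet_faces := fun _ hs =>
    ⟨hs.1, fun _ hts ht =>
      ⟨ht, ⟨fun _ hx => hs.2.1.1 (hts hx), fun A hA => hs.2.1.2 A (hA.trans hts)⟩,
        fun g hg => hs.2.2 g (hts hg)⟩⟩

/-! ### Admissible maps -/

/-- The label `min {ω I | I join-irreducible, a ⊔ I = b}` of a covering relation `a ⋖ b`. It is only
meant for covering relations of a finite lattice, where the minimum is over a nonempty set. -/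
noncomputable def edgeLabel {L : Type*} [Lattice L] (ω : {x : L // SupIrred x} → ℕ+) (a b : L) : ℕ :=
  sInf {n : ℕ | ∃ I : {x : L // SupIrred x}, a ⊔ (I : L) = b ∧ (ω I : ℕ) = n}

/-- On covering relations the minimum defining the label is attained. -/
theorem exists_edgeLabel_eq {L : Type*} [Lattice L] [BoundedOrder L] [Finite L]
    (ω : {x : L // SupIrred x} → ℕ+) {a b : L} (hab : a ⋖ b) :
    ∃ I : {x : L // SupIrred x}, a ⊔ (I : L) = b ∧ (ω I : ℕ) = edgeLabel ω a b := by
  have hne : {n : ℕ | ∃ I : {x : L // SupIrred x}, a ⊔ (I : L) = b ∧ (ω I : ℕ) = n}.Nonempty := by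
    obtain ⟨s, hs, hirr⟩ := exists_supIrred_decomposition b
    by_contra hcon
    have hle : ∀ i ∈ s, i ≤ a := by
      intro i hi
      by_contra hia
      have hib : i ≤ b := hs ▸ Finset.le_sup (f := id) hi
      refine hcon ⟨_, ⟨i, hirr hi⟩, ?_, rfl⟩
      have h1 : a < a ⊔ i := left_lt_sup.2 hia
      exact (hab.eq_or_eq h1.le (sup_le hab.le hib)).resolve_left h1.ne'
    exact hab.lt.not_ge (hs ▸ Finset.sup_le hle)
  exact Nat.sInf_mem hne

/-- `c` is a saturated chain `a = c₀ ⋖ c₁ ⋖ ⋯ ⋖ cₖ = b` (`k ≥ 0`). -/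
def IsSaturatedChain {L : Type*} [PartialOrder L] (a b : L) (c : List L) : Prop :=
  c.head? = some a ∧ c.getLast? = some b ∧ c.IsChain (· ⋖ ·)

/-- The sequence of labels of the successive steps of a chain. -/
def chainLabels {L : Type*} (lam : L → L → ℕ) (c : List L) : List ℕ :=
  List.zipWith lam c c.tail

/-- An edge labeling is an R-labeling if for all `a ≤ b` there is exactly one saturated chain from
`a` to `b` with weakly increasing labels. -/
def IsRLabeling {L : Type*} [PartialOrder L] (lam : L → L → ℕ) : Prop :=
  ∀ a b : L, a ≤ b →
    ∃! c : List L, IsSaturatedChain a b c ∧ (chainLabels lam c).IsChain (· ≤ ·)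

/-- A map `ω` from the join-irreducible elements to the positive integers is admissible if the edge
labeling it induces is an R-labeling. -/
def IsAdmissible {L : Type*} [Lattice L] (ω : {x : L // SupIrred x} → ℕ+) : Prop :=
  IsRLabeling (edgeLabel ω)

end NestedSets

/-! List the join-irreducibles by increasing `ω`. Weakly increasing chains show that for `a < b` the
first listed element `I` below `b` and not below `a` satisfies `a ⋖ a ⊔ I`
(`IsAdmissible.exists_covBy`). In the form "the rank rises by one", this property passes to lower
intervals, to upper intervals and to the join-closed part generated by all listed elements but the
last; so does the building set condition (`restrict`, `contract`, `delete`). `BuiltMinor` collects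
what is preserved, and the result is proved for it by induction on the number of generators
(`pureVD_nestedFamily`).

Let `e` be the last generator. An element `X` of `G` that is not generated by the others lies above
`e`, and its rank exceeds by one that of the largest generated element `X'` below it. Such elements
are shed from small to large. Any two of them have their join in `G`, since they share the lower
bound `e ∈ G` (`sup_mem_of_common_le`); hence removed elements incomparable to `X` do not belong to
its link anyway. Removing those below `X` leaves only generated elements there. The link of `X` is
therefore the join of the complex of the generated part of `[o, X']` with that of `[X, t]`, where
`t` is the top (`faceLink_eq`). Neither needs `e`, so induction applies to both, and the ranks add
up to one less than the total.

What remains after the shedding is the complex of the generated part, or a cone over it if `t` is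
not generated. Finally, the maximal elements of `G` are apexes, and removing apexes preserves vertex
decomposability. -/

namespace NestedSets

/-! ### Pure vertex decomposability for families of finite sets

In this section a complex is the set of all its faces, the empty face included. -/

section Complexes

variable {V W : Type*} [DecidableEq V] [DecidableEq W]

/-- The faces that avoid `v`. -/
def faceDel (C : Set (Finset V)) (v : V) : Set (Finset V) := {S | S ∈ C ∧ v ∉ S}

/-- The faces of the link of `v`. -/
def faceLink (C : Set (Finset V)) (v : V) : Set (Finset V) := {S | v ∉ S ∧ insert v S ∈ C}

/-- Vertex decomposability with the common cardinality `d` of the facets as a parameter; the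
shedding condition is forced by the cardinalities. -/
inductive PureVD : ℕ → Set (Finset V) → Prop
  | simplex (s : Finset V) : PureVD s.card {t | t ⊆ s}
  | step {d : ℕ} {C : Set (Finset V)} (v : V) (hdel : PureVD (d + 1) (faceDel C v))
      (hlink : PureVD d (faceLink C v)) : PureVD (d + 1) C

theorem PureVD.empty_mem {d : ℕ} {C : Set (Finset V)} (h : PureVD d C) : ∅ ∈ C := by
  induction h with
  | simplex s => simp
  | step v _ _ ih _ => exact ih.1

/-- Every face of a pure complex lies in a face of the top cardinality. -/
theorem PureVD.exists_facet {d : ℕ} {C : Set (Finset V)} (h : PureVD d C) :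
    ∀ S ∈ C, ∃ T ∈ C, S ⊆ T ∧ T.card = d := by
  induction h with
  | simplex s => exact fun S hS => ⟨s, Finset.Subset.refl s, hS, rfl⟩
  | @step d C v _ _ ih1 ih2 =>
    intro S hS
    by_cases hv : v ∈ S
    · obtain ⟨T, hT, hST, hc⟩ := ih2 (S.erase v)
        ⟨Finset.notMem_erase v S, by rwa [Finset.insert_erase hv]⟩
      refine ⟨insert v T, hT.2, ?_, by rw [Finset.card_insert_of_notMem hT.1, hc]⟩
      rw [← Finset.insert_erase hv]
      exact Finset.insert_subset_insert v hST
    · obtain ⟨T, hT, hST, hc⟩ := ih1 S ⟨hS, hv⟩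
      exact ⟨T, hT.1, hST, hc⟩

theorem PureVD.card_le {d : ℕ} {C : Set (Finset V)} (h : PureVD d C) :
    ∀ S ∈ C, S.card ≤ d := by
  induction h with
  | simplex s => exact fun S hS => Finset.card_le_card hS
  | @step d C v _ _ ih1 ih2 =>
    intro S hS
    by_cases hv : v ∈ S
    · have := ih2 (S.erase v) ⟨Finset.notMem_erase v S, by rwa [Finset.insert_erase hv]⟩
      rw [Finset.card_erase_of_mem hv] at this
      omega
    · exact ih1 S ⟨hS, hv⟩

theorem PureVD.card_eq_of_maximal {d : ℕ} {C : Set (Finset V)} (h : PureVD d C) {S : Finset V}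
    (hS : Maximal (· ∈ C) S) : S.card = d := by
  obtain ⟨T, hT, hST, hc⟩ := h.exists_facet S hS.prop
  rw [le_antisymm hST (hS.2 hT hST), hc]

/-- The join of two complexes whose vertices are separated by the predicate `p`. -/
theorem PureVD.join {p : V → Prop} [DecidablePred p] {d₁ d₂ : ℕ} {C₁ C₂ : Set (Finset V)}
    (h₁ : PureVD d₁ C₁) (h₂ : PureVD d₂ C₂) (hp₁ : ∀ S ∈ C₁, ∀ v ∈ S, p v)
    (hp₂ : ∀ S ∈ C₂, ∀ v ∈ S, ¬ p v) :
    PureVD (d₁ + d₂) {S | S.filter p ∈ C₁ ∧ S.filter (fun v => ¬ p v) ∈ C₂} := by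
  -- A shedding vertex of one factor sheds the join: its deletion and link in the join are again
  -- joins.
  induction h₁ with
  | simplex s =>
    induction h₂ with
    | simplex t =>
      have hs : ∀ v ∈ s, p v := hp₁ s (Finset.Subset.refl s)
      have ht : ∀ v ∈ t, ¬ p v := hp₂ t (Finset.Subset.refl t)
      have hd : Disjoint s t := Finset.disjoint_left.2 fun v hv hv' => ht v hv' (hs v hv)
      have := PureVD.simplex (s ∪ t)
      rw [Finset.card_union_of_disjoint hd] at this
      convert this using 1
      ext S
      simp only [Set.mem_ofPred_eq, Finset.subset_iff, Finset.mem_filter, Finset.mem_union]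
      constructor
      · rintro ⟨h1, h2⟩ v hv
        by_cases hpv : p v
        · exact Or.inl (h1 ⟨hv, hpv⟩)
        · exact Or.inr (h2 ⟨hv, hpv⟩)
      · intro h
        exact ⟨fun v hv => (h hv.1).resolve_right fun h' => ht v h' hv.2,
          fun v hv => (h hv.1).resolve_left fun h' => hv.2 (hs v h')⟩
    | @step d C v hdel hlink ih1 ih2 =>
      have hpv : ¬ p v := by
        have := hp₂ {v} (by simpa using hlink.empty_mem.2)
        simpa using this
      rw [← add_assoc]
      refine .step v ?_ ?_
      · rw [add_assoc]
        convert ih1 (fun S hS => hp₂ S hS.1) using 1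
        ext S
        simp [faceDel, hpv, and_assoc]
      · convert ih2 (fun S hS w hw => hp₂ _ hS.2 w (Finset.mem_insert_of_mem hw)) using 1
        ext S
        simp only [faceLink, Set.mem_ofPred_eq, Finset.filter_insert, hpv, if_false,
          not_false_eq_true, if_true, Finset.mem_filter, and_true]
        tauto
  | @step d C v hdel hlink ih1 ih2 =>
    have hpv : p v := by
      have := hp₁ {v} (by simpa using hlink.empty_mem.2)
      simpa using this
    rw [add_right_comm]
    refine .step v ?_ ?_
    · rw [add_right_comm]
      convert ih1 (fun S hS => hp₁ S hS.1) using 1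
      ext S
      simp only [faceDel, Set.mem_ofPred_eq, Finset.mem_filter, hpv, and_true]
      tauto
    · convert ih2 (fun S hS w hw => hp₁ _ hS.2 w (Finset.mem_insert_of_mem hw)) using 1
      ext S
      simp only [faceLink, Set.mem_ofPred_eq, Finset.filter_insert, hpv, if_false,
        not_true_eq_false, if_true, Finset.mem_filter, and_true]
      tauto

/-- The cone with apex `v`. -/
theorem PureVD.cone {d : ℕ} {C : Set (Finset V)} (h : PureVD d C) {v : V}
    (hv : ∀ S ∈ C, v ∉ S) : PureVD (d + 1) {S | S.erase v ∈ C} := by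
  have := (PureVD.simplex ({v} : Finset V)).join (p := fun w => w = v) h
    (by
      intro S hS w hw
      simpa using hS hw)
    (by
      rintro S hS w hw rfl
      exact hv S hS hw)
  rw [Finset.card_singleton, add_comm] at this
  convert this using 1
  ext S
  simp only [Set.mem_ofPred_eq, Finset.filter_ne' S v]
  refine ⟨fun hS => ⟨fun w hw => by simpa using (Finset.mem_filter.1 hw).2, hS⟩, And.right⟩

/-- Relabelling of the vertices. -/
theorem PureVD.comap {d : ℕ} {C : Set (Finset V)} (h : PureVD d C) {A : Set W} {f : W → V}
    (hf : Set.InjOn f A) (hC : ∀ S ∈ C, ∀ v ∈ S, v ∈ f '' A) :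
    PureVD d {S | (S : Set W) ⊆ A ∧ S.image f ∈ C} := by
  induction h with
  | simplex s =>
    obtain ⟨s, hs, rfl⟩ := Finset.subset_set_image_iff.1 (hC s (Finset.Subset.refl s))
    rw [Finset.card_image_of_injOn (hf.mono hs)]
    convert PureVD.simplex s using 1
    ext S
    simp only [Set.mem_ofPred_eq]
    constructor
    · rintro ⟨h1, h2⟩ w hw
      obtain ⟨x, hx, e⟩ := Finset.mem_image.1 (h2 (Finset.mem_image_of_mem f hw))
      rwa [← hf (hs hx) (h1 hw) e]
    · exact fun h => ⟨fun w hw => hs (h hw), Finset.image_subset_image h⟩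
  | @step d C v hdel hlink ih1 ih2 =>
    obtain ⟨w, hw, rfl⟩ : v ∈ f '' A :=
      hC {v} (by simpa using hlink.empty_mem.2) v (Finset.mem_singleton_self v)
    have key : ∀ S : Finset W, (S : Set W) ⊆ A → (f w ∈ S.image f ↔ w ∈ S) := by
      intro S hS
      rw [Finset.mem_image]
      refine ⟨?_, fun h => ⟨w, h, rfl⟩⟩
      rintro ⟨x, hx, e⟩
      rwa [← hf (hS hx) hw e]
    refine .step w ?_ ?_
    · convert ih1 (fun S hS => hC S hS.1) using 1
      ext S
      simp only [faceDel, Set.mem_ofPred_eq]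
      constructor
      · rintro ⟨⟨h1, h2⟩, h3⟩
        exact ⟨h1, h2, by rwa [key S h1]⟩
      · rintro ⟨h1, h2, h3⟩
        exact ⟨⟨h1, h2⟩, by rwa [key S h1] at h3⟩
    · convert ih2 (fun S hS x hx => hC _ hS.2 x (Finset.mem_insert_of_mem hx)) using 1
      ext S
      simp only [faceLink, Set.mem_ofPred_eq, Finset.coe_insert, Set.insert_subset_iff,
        Finset.image_insert]
      constructor
      · rintro ⟨h1, ⟨h2, h3⟩, h4⟩
        exact ⟨h3, by rwa [key S h3], h4⟩
      · rintro ⟨h1, h2, h3⟩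
        exact ⟨by rwa [key S h1] at h2, ⟨hw, h1⟩, h3⟩

/-- The link of the apex of a cone. -/
theorem PureVD.link_apex {d : ℕ} {C : Set (Finset V)} (h : PureVD d C) {v : V}
    (hv : ∀ S ∈ C, insert v S ∈ C) : ∃ d', d = d' + 1 ∧ PureVD d' (faceLink C v) := by
  induction h with
  | simplex s =>
    have hvs : v ∈ s := hv ∅ (Finset.empty_subset s) (Finset.mem_insert_self v ∅)
    refine ⟨(s.erase v).card, (Finset.card_erase_add_one hvs).symm, ?_⟩
    convert PureVD.simplex (s.erase v) using 1
    ext S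
    simp only [faceLink, Set.mem_ofPred_eq, Finset.insert_subset_iff, Finset.subset_erase]
    tauto
  | @step d C w hdel hlink ih1 ih2 =>
    refine ⟨d, rfl, ?_⟩
    by_cases hwv : w = v
    · rwa [← hwv]
    have hvw : v ≠ w := fun e => hwv e.symm
    -- The apex `v` remains an apex in the deletion and in the link of `w`, and taking the link of
    -- `v` commutes with both.
    obtain ⟨d₁, e₁, h₁⟩ := ih1 fun S hS => ⟨hv S hS.1, by simp [hwv, hS.2]⟩
    obtain ⟨d₂, e₂, h₂⟩ := ih2 fun S hS =>
      ⟨by simp [hwv, hS.1], by rw [Finset.insert_comm]; exact hv _ hS.2⟩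
    obtain rfl : d = d₁ := by omega
    subst e₂
    refine .step w ?_ ?_
    · convert h₁ using 1
      ext S
      simp only [faceDel, faceLink, Set.mem_ofPred_eq, Finset.mem_insert, hwv, false_or]
      tauto
    · convert h₂ using 1
      ext S
      simp only [faceLink, Set.mem_ofPred_eq, Finset.mem_insert, hwv, hvw, false_or,
        Finset.insert_comm w v]
      tauto

/-- Removing all apexes in a set of apexes of a complex. -/
theorem PureVD.remove_apexes {d : ℕ} {C : Set (Finset V)} (h : PureVD d C)
    (hC : ∀ S ∈ C, ∀ T ⊆ S, T ∈ C) (X : Finset V)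
    (hX : ∀ v ∈ X, ∀ S ∈ C, insert v S ∈ C) :
    ∃ d', PureVD d' {S | S ∈ C ∧ Disjoint S X} := by
  induction X using Finset.induction_on with
  | empty => exact ⟨d, by simpa using h⟩
  | insert v X hvX ih =>
    obtain ⟨d', h'⟩ := ih fun w hw => hX w (Finset.mem_insert_of_mem hw)
    obtain ⟨d'', -, h''⟩ := h'.link_apex (v := v) (by
      rintro S ⟨hS, hSX⟩
      exact ⟨hX v (Finset.mem_insert_self v X) S hS, Finset.disjoint_insert_left.2 ⟨hvX, hSX⟩⟩)
    refine ⟨d'', ?_⟩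
    -- The deletion of an apex equals its link.
    convert h'' using 1
    ext S
    simp only [faceLink, Set.mem_ofPred_eq, Finset.disjoint_insert_left,
      Finset.disjoint_insert_right]
    constructor
    · rintro ⟨h1, h2, h3⟩
      exact ⟨h2, hX v (Finset.mem_insert_self v X) S h1, hvX, h3⟩
    · rintro ⟨h1, h2, -, h3⟩
      exact ⟨hC _ h2 S (Finset.subset_insert v S), h1, h3⟩

/-- Shedding the vertices of `D` one after the other, in an order extending that of `V`. -/
theorem PureVD.of_shedding [PartialOrder V] {d : ℕ} {C : Set (Finset V)} {D : Finset V}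
    (hD : PureVD d {S | S ∈ C ∧ Disjoint S D})
    (hlink : ∀ T ⊆ D, ∀ x ∈ D, x ∉ T → (∀ y ∈ D, y < x → y ∈ T) → (∀ y ∈ T, ¬ x < y) →
      ∃ d', d = d' + 1 ∧ PureVD d' (faceLink {S | S ∈ C ∧ Disjoint S T} x)) :
    PureVD d C := by
  -- `T` is the set of vertices already removed. It stays a lower set of `D` because a minimal
  -- element of `D \ T` is shed next.
  have main : ∀ k, ∀ T ⊆ D, (D \ T).card = k → (∀ y ∈ T, ∀ x ∈ D, x < y → x ∈ T) →
      PureVD d {S | S ∈ C ∧ Disjoint S T} := by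
    intro k
    induction k with
    | zero =>
      intro T hT hk _
      rw [Finset.card_eq_zero, Finset.sdiff_eq_empty_iff_subset] at hk
      rwa [Finset.Subset.antisymm hT hk]
    | succ k ih =>
      intro T hT hk hlow
      obtain ⟨x, hx⟩ := (D \ T).exists_minimal (Finset.card_pos.1 (by omega))
      have hxD := Finset.mem_sdiff.1 hx.prop
      have hbelow : ∀ y ∈ D, y < x → y ∈ T := fun y hy hyx => by
        by_contra hyT
        exact hx.not_lt (Finset.mem_sdiff.2 ⟨hy, hyT⟩) hyx
      obtain ⟨d', rfl, hl⟩ := hlink T hT x hxD.1 hxD.2 hbelow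
        fun y hy hxy => hxD.2 (hlow y hy x hxD.1 hxy)
      refine .step x ?_ hl
      have := ih (insert x T) (Finset.insert_subset hxD.1 hT) (by
          rw [Finset.sdiff_insert, Finset.card_erase_of_mem hx.prop, hk]; rfl) (by
          intro y hy z hz hzy
          rw [Finset.mem_insert] at hy ⊢
          rcases hy with rfl | hy
          · exact Or.inr (hbelow z hz hzy)
          · exact Or.inr (hlow y hy z hz hzy))
      convert this using 1
      ext S
      simp only [faceDel, Set.mem_ofPred_eq, Finset.disjoint_insert_right]
      tauto
  simpa using main _ ∅ (Finset.empty_subset D) rfl (by simp)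

/-- Comparison with vertex decomposability of complexes in the sense of Mathlib. -/
theorem PureVD.vertexDecomposable {d : ℕ} {C : Set (Finset V)} (h : PureVD d C) :
    ∀ K : PreAbstractSimplicialComplex V, (∀ S, S ∈ K.faces ↔ S.Nonempty ∧ S ∈ C) →
      K.VertexDecomposable := by
  induction h with
  | simplex s => exact fun K hK => .simplex K ⟨s, hK⟩
  | @step d C v hdel hlink ih1 ih2 =>
    intro K hK
    have hC : PureVD (d + 1) C := .step v hdel hlink
    have hdelK : ∀ S, S ∈ (K.deletion v).faces ↔ S.Nonempty ∧ S ∈ faceDel C v := by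
      intro S
      change S ∈ K.faces ∧ v ∉ S ↔ _
      rw [hK, faceDel, Set.mem_ofPred_eq, and_assoc]
    have hvC : {v} ∈ C := by simpa using hlink.empty_mem.2
    have hvK : {v} ∈ K.faces := (hK _).2 ⟨Finset.singleton_nonempty v, hvC⟩
    have hmax : ∀ S, K.IsFacet S → Maximal (· ∈ C) S := fun S hS =>
      ⟨((hK S).1 hS.prop).2, fun T hT hST =>
        hS.le_of_ge ((hK T).2 ⟨((hK S).1 hS.prop).1.mono hST, hT⟩) hST⟩
    refine .step K v hvK (fun s t hs ht => ?_) (fun S hS => ?_) (ih1 _ hdelK) (ih2 _ ?_)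
    · rw [hC.card_eq_of_maximal (hmax s hs), hC.card_eq_of_maximal (hmax t ht)]
    · have hS' := (hdelK S).1 hS.prop
      have hcard : S.card = d + 1 := hdel.card_eq_of_maximal
        ⟨hS'.2, fun T hT hST => hS.le_of_ge ((hdelK T).2 ⟨hS'.1.mono hST, hT⟩) hST⟩
      refine ⟨(hK S).2 ⟨hS'.1, hS'.2.1⟩, fun T hT hST => ?_⟩
      have := hC.card_le T ((hK T).1 hT).2
      exact (Finset.eq_of_subset_of_card_le hST (by omega)).symm.subset
    · intro S
      change S.Nonempty ∧ (∃ h : v ∉ S, Finset.cons v S h ∈ K.faces) ↔ _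
      refine and_congr_right fun _ => ?_
      simp only [Finset.cons_eq_insert, hK, faceLink, Set.mem_ofPred_eq, exists_prop,
        Finset.insert_nonempty, true_and]

end Complexes

/-! ### Minors of a lattice with a building set

Intervals and deletions are represented by subsets of one ambient join-semilattice. -/

section Minors

variable {L : Type*} [SemilatticeSup L]

/-- `F` is the nontrivial product of `y` and `z` in `M`, compatibly with `G`. -/
structure Splits (M G : Set L) (F y z : L) : Prop where
  left_mem : y ∈ M
  right_mem : z ∈ M
  left_ne : y ≠ F
  right_ne : z ≠ F
  sup_eq : y ⊔ z = F
  le_or_le : ∀ g ∈ G, g ≤ F → g ≤ y ∨ g ≤ z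
  le_and_le : ∀ u ∈ M, ∀ v ∈ M, ∀ w ∈ M, ∀ t ∈ M, u ≤ y → v ≤ y → w ≤ z → t ≤ z →
    u ⊔ w ≤ v ⊔ t → u ≤ v ∧ w ≤ t

theorem Splits.symm {M G : Set L} {F y z : L} (h : Splits M G F y z) : Splits M G F z y where
  left_mem := h.right_mem
  right_mem := h.left_mem
  left_ne := h.right_ne
  right_ne := h.left_ne
  sup_eq := by rw [sup_comm, h.sup_eq]
  le_or_le g hg hgF := (h.le_or_le g hg hgF).symm
  le_and_le u hu v hv w hw t ht h1 h2 h3 h4 h5 :=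
    (h.le_and_le w hw t ht u hu v hv h3 h4 h1 h2 (by rwa [sup_comm w, sup_comm t])).symm

theorem Splits.left_le {M G : Set L} {F y z : L} (h : Splits M G F y z) : y ≤ F :=
  h.sup_eq ▸ le_sup_left

theorem Splits.right_le {M G : Set L} {F y z : L} (h : Splits M G F y z) : z ≤ F :=
  h.sup_eq ▸ le_sup_right

/-- A join-closed set `M` with least element `o`, a building set `G` of it, and a sequence
`φ 0, …, φ (n - 1)` of generators in `G ∪ {o}` such that for `a < b` in `M` the first generator
below `b` and not below `a` raises the rank of `a` by one. -/
structure BuiltMinor (r : L → ℕ) (M : Set L) (o : L) (G : Set L) (φ : ℕ → L) (n : ℕ) : Prop where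
  bot_mem : o ∈ M
  bot_le : ∀ x ∈ M, o ≤ x
  supClosed : SupClosed M
  subset : G ⊆ M
  bot_notMem : o ∉ G
  gen_mem : ∀ i < n, ∀ b ∈ M, φ i ≤ b → φ i = o ∨ φ i ∈ G
  step : ∀ a ∈ M, ∀ b ∈ M, a < b →
    ∃ i < n, φ i ≤ b ∧ ¬ φ i ≤ a ∧ r (a ⊔ φ i) = r a + 1 ∧ ∀ j < i, φ j ≤ b → φ j ≤ a
  split : ∀ F ∈ M, F ≠ o → F ∉ G → ∃ y z, Splits M G F y z

/-- The contraction of the building set `G` by `X`. -/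
def contraction (G : Set L) (X : L) : Set L := {k | ∃ h ∈ G, ¬ h ≤ X ∧ X ⊔ h = k}

/-- The elements of `M` generated by the first `n` generators. -/
def generated (M : Set L) (φ : ℕ → L) (n : ℕ) : Set L :=
  {x | x ∈ M ∧ ∀ y ∈ M, (∀ j < n, φ j ≤ x → φ j ≤ y) → x ≤ y}

/-- The vertices of the link of `X` that are not below `X`. -/
def compatible (G : Set L) (X : L) : Set L := {h | h ∈ G ∧ ¬ h ≤ X ∧ (X ≤ h ∨ h ⊔ X ∉ G)}

/-- The vertex representing `X ⊔ h` is `X ⊔ h` itself when that lies in `G`, and `h` otherwise.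
Together with `injOn_compatible` this identifies the vertices of the contraction with those of the
link of `X` not below `X`. -/
theorem contraction_subset_image (G : Set L) (X : L) :
    contraction G X ⊆ (X ⊔ ·) '' compatible G X := by
  rintro _ ⟨h, hG, hX, rfl⟩
  by_cases hm : X ⊔ h ∈ G
  · exact ⟨X ⊔ h, ⟨hm, fun hle => hX (le_sup_right.trans hle), Or.inl le_sup_left⟩, by simp⟩
  · exact ⟨h, ⟨hG, hX, Or.inr (by rwa [sup_comm])⟩, rfl⟩

theorem exists_isGreatest_of_supClosed [Finite L] {N : Set L} (hN : SupClosed N)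
    (hne : N.Nonempty) : ∃ m, IsGreatest N m := by
  obtain ⟨m, hm⟩ := N.toFinite.exists_maximal hne
  exact ⟨m, hm.prop, fun a ha => le_sup_right.trans (hm.le_of_ge (hN hm.prop ha) le_sup_left)⟩

theorem supClosed_generated {M : Set L} (hM : SupClosed M) (φ : ℕ → L) (n : ℕ) :
    SupClosed (generated M φ n) := fun _ ha _ hb =>
  ⟨hM ha.1 hb.1, fun y hy h => sup_le (ha.2 y hy fun j hj hja => h j hj (hja.trans le_sup_left))
    (hb.2 y hy fun j hj hjb => h j hj (hjb.trans le_sup_right))⟩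

/-! ### Restriction, contraction and deletion; factors of joins -/

namespace BuiltMinor

variable {r : L → ℕ} {M : Set L} {o : L} {G : Set L} {φ : ℕ → L} {n : ℕ}

theorem gen_mem_carrier (D : BuiltMinor r M o G φ n) {i : ℕ} (hi : i < n) {b : L} (hb : b ∈ M)
    (h : φ i ≤ b) : φ i ∈ M := by
  rcases D.gen_mem i hi b hb h with e | e
  · rw [e]; exact D.bot_mem
  · exact D.subset e

theorem gen_mem_of_not_le (D : BuiltMinor r M o G φ n) {i : ℕ} (hi : i < n) {a b : L}
    (ha : a ∈ M) (hb : b ∈ M) (h : φ i ≤ b) (h' : ¬ φ i ≤ a) : φ i ∈ G :=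
  (D.gen_mem i hi b hb h).resolve_left fun e => h' (e ▸ D.bot_le a ha)

/-- Surjectivity of the product map onto the elements below `F`. Meets in `M` are not at hand, so a
maximal decomposable element below `x` is taken: were it smaller than `x`, the next generator would
lie in `G`, hence below `y` or `z`, and could be absorbed into that component. -/
theorem exists_sup_eq [Finite L] (D : BuiltMinor r M o G φ n) {F y z x : L}
    (h : Splits M G F y z) (hx : x ∈ M) (hxF : x ≤ F) :
    ∃ u ∈ M, ∃ w ∈ M, u ≤ y ∧ w ≤ z ∧ u ⊔ w = x := by
  let N : Set L := {a | a ≤ x ∧ ∃ u ∈ M, ∃ w ∈ M, u ≤ y ∧ w ≤ z ∧ u ⊔ w = a}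
  have hne : N.Nonempty := ⟨o, D.bot_le x hx, o, D.bot_mem, o, D.bot_mem,
    D.bot_le y h.left_mem, D.bot_le z h.right_mem, sup_idem o⟩
  obtain ⟨a, ha⟩ := N.toFinite.exists_maximal hne
  obtain ⟨hax, u, hu, w, hw, huy, hwz, rfl⟩ := ha.prop
  refine ⟨u, hu, w, hw, huy, hwz, ?_⟩
  by_contra hne
  obtain ⟨i, hi, hix, hia, -⟩ := D.step _ (D.supClosed hu hw) x hx (lt_of_le_of_ne hax hne)
  have hG := D.gen_mem_of_not_le hi (D.supClosed hu hw) hx hix hia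
  refine hia (le_sup_right.trans (ha.le_of_ge (y := u ⊔ w ⊔ φ i) ⟨sup_le hax hix, ?_⟩ le_sup_left))
  rcases h.le_or_le _ hG (hix.trans hxF) with hy | hz
  · exact ⟨u ⊔ φ i, D.supClosed hu (D.subset hG), w, hw, sup_le huy hy, hwz,
      sup_right_comm u (φ i) w⟩
  · exact ⟨u, hu, w ⊔ φ i, D.supClosed hw (D.subset hG), huy, sup_le hwz hz,
      (sup_assoc u w (φ i)).symm⟩

/-- Lower intervals. -/
theorem restrict (D : BuiltMinor r M o G φ n) {x : L} (hx : x ∈ M) :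
    BuiltMinor r (M ∩ Set.Iic x) o (G ∩ Set.Iic x) φ n where
  bot_mem := ⟨D.bot_mem, D.bot_le x hx⟩
  bot_le y hy := D.bot_le y hy.1
  supClosed _ ha _ hb := ⟨D.supClosed ha.1 hb.1, sup_le ha.2 hb.2⟩
  subset := Set.inter_subset_inter_left _ D.subset
  bot_notMem h := D.bot_notMem h.1
  gen_mem i hi b hb h := (D.gen_mem i hi b hb.1 h).imp_right fun h' => ⟨h', h.trans hb.2⟩
  step a ha b hb hab := D.step a ha.1 b hb.1 hab
  split F hF hFo hFG := by
    obtain ⟨y, z, h⟩ := D.split F hF.1 hFo fun h => hFG ⟨h, hF.2⟩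
    exact ⟨y, z, ⟨h.left_mem, h.left_le.trans hF.2⟩, ⟨h.right_mem, h.right_le.trans hF.2⟩,
      h.left_ne, h.right_ne, h.sup_eq, fun g hg => h.le_or_le g hg.1,
      fun u hu v hv w hw t ht => h.le_and_le u hu.1 v hv.1 w hw.1 t ht.1⟩

/-- Upper intervals. -/
theorem contract [Finite L] (D : BuiltMinor r M o G φ n) {X : L} (hX : X ∈ G) :
    BuiltMinor r (M ∩ Set.Ici X) X (contraction G X) (fun i => X ⊔ φ i) n where
  bot_mem := ⟨D.subset hX, le_rfl⟩
  bot_le y hy := hy.2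
  supClosed _ ha _ hb := ⟨D.supClosed ha.1 hb.1, le_sup_of_le_left ha.2⟩
  subset := by
    rintro _ ⟨h, hG, -, rfl⟩
    exact ⟨D.supClosed (D.subset hX) (D.subset hG), le_sup_left⟩
  bot_notMem := by
    rintro ⟨h, -, hle, e⟩
    exact hle (sup_eq_left.1 e)
  gen_mem i hi b hb hle := by
    by_cases h : φ i ≤ X
    · exact Or.inl (sup_eq_left.2 h)
    · exact Or.inr ⟨φ i, D.gen_mem_of_not_le hi (D.subset hX) hb.1 (le_sup_right.trans hle) h,
        h, rfl⟩
  step a ha b hb hab := by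
    obtain ⟨i, hi, h1, h2, h3, h4⟩ := D.step a ha.1 b hb.1 hab
    refine ⟨i, hi, sup_le hb.2 h1, fun h => h2 (le_sup_right.trans h), ?_,
      fun j hj hjb => sup_le ha.2 (h4 j hj (le_sup_right.trans hjb))⟩
    rwa [← sup_assoc, sup_eq_left.2 ha.2]
  split F hF hFX hFG := by
    have hXM := D.subset hX
    have hXF : X ≤ F := hF.2
    have hlt : X < F := lt_of_le_of_ne hXF (Ne.symm hFX)
    have hnot : ∀ h ∈ G, X ⊔ h ≠ F := fun h hG e =>
      hFG ⟨h, hG, fun hle => hFX (by rw [← e, sup_eq_left.2 hle]), e⟩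
    have main : ∀ y z, Splits M G F y z → X ≤ y →
        ∃ y z, Splits (M ∩ Set.Ici X) (contraction G X) F y z := by
      intro y z h hXy
      have hyM := h.left_mem
      have hzM := h.right_mem
      -- When `y = X` the first factor becomes trivial over `X`. Then `z ∉ G`, as otherwise `F = X ⊔
      -- z` would lie in the contraction, so `z` splits in turn. When `y ≠ X` the factors are `y`
      -- and `X ⊔ z`.
      by_cases hyX : y = X
      · subst hyX
        have hzo : z ≠ o := by
          rintro rfl
          exact h.left_ne (by rw [← h.sup_eq, sup_eq_left.2 (D.bot_le _ hyM)])
        obtain ⟨z₁, z₂, k⟩ := D.split z hzM hzo fun hzG => hnot z hzG h.sup_eq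
        have hne : ∀ z' ∈ M, z' ≤ z → z' ≠ z → y ⊔ z' ≠ F := by
          intro z' hz' hle hne e
          have := (h.le_and_le y hyM y hyM z hzM z' hz' le_rfl le_rfl le_rfl hle
            (by rw [e, h.sup_eq])).2
          exact hne (le_antisymm hle this)
        refine ⟨y ⊔ z₁, y ⊔ z₂, ⟨D.supClosed hyM k.left_mem, le_sup_left⟩,
          ⟨D.supClosed hyM k.right_mem, le_sup_left⟩, hne _ k.left_mem k.left_le k.left_ne,
          hne _ k.right_mem k.right_le k.right_ne, ?_, ?_, ?_⟩
        · rw [← sup_sup_distrib_left, k.sup_eq, h.sup_eq]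
        · rintro _ ⟨g, hg, hgy, rfl⟩ hgF
          have hgz := (h.le_or_le g hg (le_sup_right.trans hgF)).resolve_left hgy
          exact (k.le_or_le g hg hgz).imp (sup_le_sup_left · y) (sup_le_sup_left · y)
        · have lift : ∀ z' ∈ M, z' ≤ z → ∀ u ∈ M ∩ Set.Ici y, u ≤ y ⊔ z' →
              ∃ w ∈ M, w ≤ z' ∧ y ⊔ w = u := by
            intro z' hz' hle u hu hu'
            obtain ⟨c, hc, w, hw, hcy, hwz, rfl⟩ := D.exists_sup_eq h hu.1
              (hu'.trans (sup_le h.left_le (hle.trans h.right_le)))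
            refine ⟨w, hw, (h.le_and_le c hc y hyM w hw z' hz' hcy le_rfl hwz hle hu').2, ?_⟩
            exact le_antisymm (sup_le hu.2 le_sup_right) (sup_le_sup_right hcy w)
          intro u hu v hv w hw t ht huy hvy hwz htz hle
          obtain ⟨u', hu', hu'z, rfl⟩ := lift z₁ k.left_mem k.left_le u hu huy
          obtain ⟨v', hv', hv'z, rfl⟩ := lift z₁ k.left_mem k.left_le v hv hvy
          obtain ⟨w', hw', hw'z, rfl⟩ := lift z₂ k.right_mem k.right_le w hw hwz
          obtain ⟨t', ht', ht'z, rfl⟩ := lift z₂ k.right_mem k.right_le t ht htz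
          rw [← sup_sup_distrib_left, ← sup_sup_distrib_left] at hle
          have h1 := (h.le_and_le y hyM y hyM _ (D.supClosed hu' hw') _ (D.supClosed hv' ht')
            le_rfl le_rfl (sup_le (hu'z.trans k.left_le) (hw'z.trans k.right_le))
            (sup_le (hv'z.trans k.left_le) (ht'z.trans k.right_le)) hle).2
          have h2 := k.le_and_le u' hu' v' hv' w' hw' t' ht' hu'z hv'z hw'z ht'z h1
          exact ⟨sup_le_sup_left h2.1 y, sup_le_sup_left h2.2 y⟩
      · refine ⟨y, X ⊔ z, ⟨hyM, hXy⟩, ⟨D.supClosed hXM hzM, le_sup_left⟩, h.left_ne, ?_, ?_, ?_, ?_⟩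
        · intro e
          have := (h.le_and_le y hyM X hXM z hzM z hzM le_rfl hXy le_rfl le_rfl
            (by rw [e, h.sup_eq])).1
          exact hyX (le_antisymm this hXy)
        · rw [← sup_assoc, sup_eq_left.2 hXy, h.sup_eq]
        · rintro _ ⟨g, hg, -, rfl⟩ hgF
          exact (h.le_or_le g hg (le_sup_right.trans hgF)).imp (sup_le hXy) (sup_le_sup_left · X)
        · have lift : ∀ u ∈ M ∩ Set.Ici X, u ≤ X ⊔ z → ∃ w ∈ M, w ≤ z ∧ X ⊔ w = u := by
            intro u hu hu'
            obtain ⟨c, hc, w, hw, hcy, hwz, rfl⟩ := D.exists_sup_eq h hu.1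
              (hu'.trans (sup_le hXF h.right_le))
            have := (h.le_and_le c hc X hXM w hw z hzM hcy hXy hwz le_rfl hu').1
            exact ⟨w, hw, hwz, le_antisymm (sup_le hu.2 le_sup_right) (sup_le_sup_right this w)⟩
          intro u hu v hv w hw t ht huy hvy hwz htz hle
          obtain ⟨w', hw', hw'z, rfl⟩ := lift w hw hwz
          obtain ⟨t', ht', ht'z, rfl⟩ := lift t ht htz
          rw [← sup_assoc, ← sup_assoc, sup_eq_left.2 hu.2, sup_eq_left.2 hv.2] at hle
          have := h.le_and_le u hu.1 v hv.1 w' hw' t' ht' huy hvy hw'z ht'z hle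
          exact ⟨this.1, sup_le_sup_left this.2 X⟩
    have hFo : F ≠ o := fun e => (hlt.trans_le (e ▸ D.bot_le X hXM)).false
    obtain ⟨y, z, h⟩ := D.split F hF.1 hFo fun hG => hnot F hG (sup_eq_right.2 hXF)
    rcases h.le_or_le X hX hXF with hy | hz
    · exact main y z h hy
    · exact main z y h.symm hz

/-- A trivial last generator may be dropped. -/
theorem drop_last (D : BuiltMinor r M o G φ (n + 1)) (h : φ n ≤ o) :
    BuiltMinor r M o G φ n where
  bot_mem := D.bot_mem
  bot_le := D.bot_le
  supClosed := D.supClosed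
  subset := D.subset
  bot_notMem := D.bot_notMem
  gen_mem i hi := D.gen_mem i (hi.trans (Nat.lt_succ_self n))
  step a ha b hb hab := by
    obtain ⟨i, hi, h1, h2, h3⟩ := D.step a ha b hb hab
    refine ⟨i, lt_of_le_of_ne (Nat.le_of_lt_succ hi) ?_, h1, h2, h3⟩
    rintro rfl
    exact h2 (h.trans (D.bot_le a ha))
  split := D.split

theorem bot_mem_generated (D : BuiltMinor r M o G φ n) (m : ℕ) : o ∈ generated M φ m :=
  ⟨D.bot_mem, fun y hy _ => D.bot_le y hy⟩

theorem gen_mem_generated (D : BuiltMinor r M o G φ (n + 1)) {i : ℕ} (hi : i < n) {b : L}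
    (hb : b ∈ M) (h : φ i ≤ b) : φ i ∈ generated M φ n :=
  ⟨D.gen_mem_carrier (hi.trans (Nat.lt_succ_self n)) hb h, fun _ _ h' => h' i hi le_rfl⟩

theorem exists_isGreatest_generated [Finite L] (D : BuiltMinor r M o G φ n) (m : ℕ) {x : L}
    (hx : x ∈ M) : ∃ x', IsGreatest (generated M φ m ∩ Set.Iic x) x' :=
  exists_isGreatest_of_supClosed
    (fun _ ha _ hb => ⟨supClosed_generated D.supClosed φ m ha.1 hb.1, sup_le ha.2 hb.2⟩)
    ⟨o, D.bot_mem_generated m, D.bot_le x hx⟩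

/-- Deletion of the last generator. -/
theorem delete [Finite L] (D : BuiltMinor r M o G φ (n + 1)) :
    BuiltMinor r (generated M φ n) o (G ∩ generated M φ n) φ n where
  bot_mem := D.bot_mem_generated n
  bot_le y hy := D.bot_le y hy.1
  supClosed := supClosed_generated D.supClosed φ n
  subset := Set.inter_subset_right
  bot_notMem h := D.bot_notMem h.1
  gen_mem i hi b hb h := (D.gen_mem i (hi.trans (Nat.lt_succ_self n)) b hb.1 h).imp_right
    fun h' => ⟨h', D.gen_mem_generated hi hb.1 h⟩
  step a ha b hb hab := by
    obtain ⟨i, hi, h1, h2, h3, h4⟩ := D.step a ha.1 b hb.1 hab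
    refine ⟨i, lt_of_le_of_ne (Nat.le_of_lt_succ hi) ?_, h1, h2, h3, h4⟩
    rintro rfl
    -- If the first generator were the last one, all others below `b` would lie below `a`, forcing
    -- `b ≤ a` since `b` is generated.
    exact hab.not_ge (hb.2 a ha.1 h4)
  split F hF hFo hFG := by
    obtain ⟨y, z, h⟩ := D.split F hF.1 hFo fun hG => hFG ⟨hG, hF⟩
    -- Factors of a generated element are generated: with `y'` the largest generated element below
    -- `y`, the join `y' ⊔ z` dominates every generator below `F` other than the last, hence `F`,
    -- and the product order gives `y ≤ y'`.
    have left : ∀ y z, Splits M G F y z → y ∈ generated M φ n := by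
      intro y z h
      obtain ⟨y', hy', hmax⟩ := D.exists_isGreatest_generated n h.left_mem
      have hle : F ≤ y' ⊔ z := by
        refine hF.2 _ (D.supClosed hy'.1.1 h.right_mem) fun j hj hjF => ?_
        have hor : φ j ≤ y ∨ φ j ≤ z := by
          rcases D.gen_mem j (hj.trans (Nat.lt_succ_self n)) F hF.1 hjF with e | e
          · exact Or.inl (e ▸ D.bot_le y h.left_mem)
          · exact h.le_or_le _ e hjF
        rcases hor with hjy | hjz
        · exact le_sup_of_le_left (hmax ⟨D.gen_mem_generated hj hF.1 hjF, hjy⟩)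
        · exact le_sup_of_le_right hjz
      have := (h.le_and_le y h.left_mem y' hy'.1.1 z h.right_mem z h.right_mem le_rfl hy'.2 le_rfl
        le_rfl (h.sup_eq.trans_le hle)).1
      rw [le_antisymm this hy'.2]
      exact hy'.1
    exact ⟨y, z, left y z h, left z y h.symm, h.left_ne, h.right_ne, h.sup_eq,
      fun g hg => h.le_or_le g hg.1,
      fun u hu v hv w hw t ht => h.le_and_le u hu.1 v hv.1 w hw.1 t ht.1⟩

/-- An element that needs the last generator is a product with a factor of rank one over the
part generated by the other generators. -/
theorem rank_of_notMem_generated [Finite L] (D : BuiltMinor r M o G φ (n + 1)) {x x' : L}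
    (hx : x ∈ M) (hxg : x ∉ generated M φ n)
    (hx' : IsGreatest (generated M φ n ∩ Set.Iic x) x') :
    r x = r x' + 1 ∧ φ n ≤ x ∧ ¬ φ n ≤ x' := by
  have hgen : ∀ j < n, φ j ≤ x → φ j ≤ x' := fun j hj hjx =>
    hx'.2 ⟨D.gen_mem_generated hj hx hjx, hjx⟩
  have hlt : x' < x := lt_of_le_of_ne hx'.1.2 fun e => hxg (e ▸ hx'.1.1)
  obtain ⟨i, hi, h1, h2, h3, -⟩ := D.step x' hx'.1.1.1 x hx hlt
  obtain rfl : i = n := by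
    by_contra hne
    exact h2 (hgen i (lt_of_le_of_ne (Nat.le_of_lt_succ hi) hne) h1)
  refine ⟨?_, h1, h2⟩
  have he : φ i ∈ M := D.gen_mem_carrier hi hx h1
  -- No generator below `x` is left to lead from `x' ⊔ φ n` further up.
  have hsup : x' ⊔ φ i = x := by
    by_contra hne
    obtain ⟨j, hj, k1, k2, -⟩ := D.step _ (D.supClosed hx'.1.1.1 he) x hx
      (lt_of_le_of_ne (sup_le hx'.1.2 h1) hne)
    rcases Nat.lt_succ_iff_lt_or_eq.1 hj with hj | rfl
    · exact k2 (le_sup_of_le_left (hgen j hj k1))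
    · exact k2 le_sup_right
  rwa [hsup] at h3

/-- Two elements of `G` whose join is not in `G` are the factors of their join. -/
theorem splits_of_sup_notMem (D : BuiltMinor r M o G φ n) {h x : L} (hh : h ∈ G) (hx : x ∈ G)
    (hhx : h ⊔ x ∉ G) : Splits M G (h ⊔ x) h x := by
  have hhM := D.subset hh
  have hxM := D.subset hx
  have hne : h ⊔ x ≠ o := fun e => D.bot_notMem <| by
    rwa [← le_antisymm (e ▸ le_sup_left : h ≤ o) (D.bot_le h hhM)]
  obtain ⟨y, z, s⟩ := D.split _ (D.supClosed hhM hxM) hne hhx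
  have main : ∀ y z, Splits M G (h ⊔ x) y z → h ≤ y → Splits M G (h ⊔ x) h x := by
    intro y z s hy
    have hz : x ≤ z := (s.le_or_le x hx le_sup_right).resolve_left fun hxy =>
      s.left_ne (le_antisymm s.left_le (sup_le hy hxy))
    -- Comparing `y ⊔ z ≤ h ⊔ x` componentwise forces `y = h` and `z = x`.
    have := s.le_and_le y s.left_mem h hhM z s.right_mem x hxM le_rfl hy le_rfl hz s.sup_eq.le
    have e₁ := le_antisymm hy this.1
    have e₂ := le_antisymm hz this.2
    subst e₁ e₂
    exact s
  rcases s.le_or_le h hh le_sup_left with hy | hz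
  · exact main y z s hy
  · exact main z y s.symm hz

/-- Otherwise `h` and `x` would be the two factors of their join, and an element below both factors
of a product is trivial. -/
theorem sup_mem_of_common_le (D : BuiltMinor r M o G φ n) {e h x : L} (he : e ∈ G) (hh : h ∈ G)
    (hx : x ∈ G) (heh : e ≤ h) (hex : e ≤ x) : h ⊔ x ∈ G := by
  by_contra hhx
  have heM := D.subset he
  have := ((D.splits_of_sup_notMem hh hx hhx).le_and_le e heM o D.bot_mem o D.bot_mem e heM heh
    (D.bot_le h (D.subset hh)) (D.bot_le x (D.subset hx)) hex (by rw [sup_comm])).1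
  exact D.bot_notMem (by rwa [← le_antisymm this (D.bot_le e heM)])

/-- Either `X ⊔ b = b`, or `X` and `b` are the factors of their join and `g ∈ G` lies below one of
them. -/
theorem le_of_mem_compatible (D : BuiltMinor r M o G φ n) {X b g : L} (hX : X ∈ G)
    (hb : b ∈ compatible G X) (hg : g ∈ G) (hgX : ¬ g ≤ X) (hle : g ≤ X ⊔ b) : g ≤ b := by
  rcases hb.2.2 with h | h
  · rwa [sup_eq_right.2 h] at hle
  · rw [sup_comm] at hle
    exact ((D.splits_of_sup_notMem hb.1 hX h).le_or_le g hg hle).resolve_right hgX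

theorem injOn_compatible (D : BuiltMinor r M o G φ n) {X : L} (hX : X ∈ G) :
    Set.InjOn (X ⊔ ·) (compatible G X) := by
  intro a ha b hb (hab : X ⊔ a = X ⊔ b)
  exact le_antisymm (D.le_of_mem_compatible hX hb ha.1 ha.2.1 (hab ▸ le_sup_right))
    (D.le_of_mem_compatible hX ha hb.1 hb.2.1 (hab ▸ le_sup_right))

end BuiltMinor

end Minors

/-! ### Links and deletions of nested set complexes -/

section Nested

variable {L : Type*} [SemilatticeSup L] [OrderBot L]

/-- The nested sets of `G`, where maximal elements of `G` are allowed. -/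
def nestedFamily (G : Set L) : Set (Finset L) :=
  {S | (S : Set L) ⊆ G ∧ ∀ B ⊆ S, B.Nonempty → B.sup id ∈ G → B.sup id ∈ B}

theorem mem_nestedFamily_of_subset {G : Set L} {S T : Finset L} (hS : S ∈ nestedFamily G)
    (hT : T ⊆ S) : T ∈ nestedFamily G :=
  ⟨fun _ hx => hS.1 (hT hx), fun B hB => hS.2 B (hB.trans hT)⟩

theorem mem_nestedFamily_inter {G N : Set L} (hN : SupClosed N) {S : Finset L} :
    S ∈ nestedFamily (G ∩ N) ↔ S ∈ nestedFamily G ∧ (S : Set L) ⊆ N := by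
  constructor
  · rintro ⟨h1, h2⟩
    refine ⟨⟨fun x hx => (h1 hx).1, fun B hB hne hG => h2 B hB hne ⟨hG, ?_⟩⟩,
      fun x hx => (h1 hx).2⟩
    exact hN.finsetSup_mem hne fun i hi => (h1 (hB hi)).2
  · rintro ⟨⟨h1, h2⟩, h3⟩
    exact ⟨fun x hx => ⟨h1 hx, h3 hx⟩, fun B hB hne hG => h2 B hB hne hG.1⟩

/-- A subset containing `g` with join in `G` has join `g` by maximality; so maximal elements of `G`
are apexes. -/
theorem insert_mem_nestedFamily [DecidableEq L] {G : Set L} {S : Finset L} {g : L}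
    (hS : S ∈ nestedFamily G) (hg : g ∈ G) (hmax : ∀ x ∈ G, g ≤ x → x = g) :
    insert g S ∈ nestedFamily G := by
  refine ⟨by rw [Finset.coe_insert]; exact Set.insert_subset hg hS.1, fun B hB hne hG => ?_⟩
  by_cases hgB : g ∈ B
  · rwa [hmax _ hG (Finset.le_sup (f := id) hgB)]
  · exact hS.2 B ((Finset.subset_insert_iff_of_notMem hgB).1 hB) hne hG

theorem sup_image_sup [DecidableEq L] (X : L) {B : Finset L} (hB : B.Nonempty) :
    (B.image (X ⊔ ·)).sup id = X ⊔ B.sup id := by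
  rw [Finset.sup_image]
  refine le_antisymm (Finset.sup_le fun b hb => ?_) (sup_le ?_ (Finset.sup_le fun b hb => ?_))
  · exact sup_le_sup_left (Finset.le_sup (f := id) hb) X
  · obtain ⟨b, hb⟩ := hB
    exact le_sup_left.trans (Finset.le_sup (f := id ∘ (X ⊔ ·)) hb)
  · exact le_sup_right.trans (Finset.le_sup (f := id ∘ (X ⊔ ·)) hb)

/-! ### Links as joins, and the induction on the number of generators -/

namespace BuiltMinor

variable {r : L → ℕ} {M : Set L} {o : L} {G : Set L} {φ : ℕ → L} {n : ℕ}

/-- The link of `X` in the nested sets of `G`. -/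
theorem insert_mem_nestedFamily_iff [DecidableEq L] (D : BuiltMinor r M o G φ n) {X : L}
    [DecidablePred (· ≤ X)] (hX : X ∈ G) {S : Finset L} :
    insert X S ∈ nestedFamily G ↔ S.filter (· ≤ X) ∈ nestedFamily G ∧
      (S.filter (fun h => ¬ h ≤ X) : Set L) ⊆ compatible G X ∧
      (S.filter (fun h => ¬ h ≤ X)).image (X ⊔ ·) ∈ nestedFamily (contraction G X) := by
  constructor
  · intro hS
    have hSG : ∀ h ∈ S, h ∈ G := fun h hh => hS.1 (Finset.mem_insert_of_mem hh)
    refine ⟨mem_nestedFamily_of_subset hS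
      ((Finset.filter_subset _ S).trans (Finset.subset_insert X S)), ?_, ?_, ?_⟩
    · intro h hh
      obtain ⟨hhS, hhX⟩ := Finset.mem_filter.1 (Finset.mem_coe.1 hh)
      refine ⟨hSG h hhS, hhX, or_iff_not_imp_right.2 fun hm => ?_⟩
      have := hS.2 {h, X} (by
        intro x hx
        rcases Finset.mem_insert.1 hx with rfl | hx
        · exact Finset.mem_insert_of_mem hhS
        · rw [Finset.mem_singleton.1 hx]; exact Finset.mem_insert_self X S)
        (Finset.insert_nonempty _ _) (by simpa using hm)
      simp only [Finset.sup_insert, Finset.sup_singleton, id, Finset.mem_insert,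
        Finset.mem_singleton, sup_eq_left, sup_eq_right] at this
      exact this.resolve_right hhX
    · intro k hk
      obtain ⟨h, hh, rfl⟩ := Finset.mem_image.1 (Finset.mem_coe.1 hk)
      exact ⟨h, hSG h (Finset.mem_filter.1 hh).1, (Finset.mem_filter.1 hh).2, rfl⟩
    · intro B' hB' hne hG
      obtain ⟨B, hB, rfl⟩ := Finset.subset_image_iff.1 hB'
      have hBS : ∀ b ∈ B, b ∈ S ∧ ¬ b ≤ X := fun b hb => Finset.mem_filter.1 (hB hb)
      have hneB : B.Nonempty := Finset.image_nonempty.1 hne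
      rw [sup_image_sup X hneB] at hG ⊢
      obtain ⟨g, hg, hgX, e⟩ := hG
      rw [Finset.mem_image]
      -- If `X ⊔ g ∈ G`, nestedness applies to `B` with `X` added. Otherwise `X` and `g` are
      -- factors, all of `B` lies below `g`, and the product order gives `B.sup id = g`.
      by_cases hm : X ⊔ g ∈ G
      · have := hS.2 (insert X B)
          (Finset.insert_subset_insert X fun b hb => (hBS b hb).1)
          (Finset.insert_nonempty _ _) (by rwa [Finset.sup_insert, id, ← e])
        rw [Finset.sup_insert, id, ← e, Finset.mem_insert, sup_eq_left] at this
        refine ⟨_, this.resolve_left hgX, ?_⟩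
        rw [← e, sup_left_idem]
      · have s := D.splits_of_sup_notMem hX hg hm
        have hle : B.sup id ≤ g := Finset.sup_le fun b hb =>
          (s.le_or_le b (hSG b (hBS b hb).1)
            (e ▸ le_sup_of_le_right (Finset.le_sup (f := id) hb))).resolve_left (hBS b hb).2
        have hBM : B.sup id ∈ M :=
          D.supClosed.finsetSup_mem hneB fun b hb => D.subset (hSG b (hBS b hb).1)
        have hge := (s.le_and_le X (D.subset hX) X (D.subset hX) g (D.subset hg) _ hBM le_rfl
          le_rfl le_rfl hle e.le).2
        have heq : B.sup id = g := le_antisymm hle hge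
        exact ⟨B.sup id, hS.2 B (fun b hb => Finset.mem_insert_of_mem (hBS b hb).1) hneB
          (heq ▸ hg), rfl⟩
  · rintro ⟨h1, h2, h3⟩
    refine ⟨?_, fun B hB hne hG => ?_⟩
    · rw [Finset.coe_insert]
      refine Set.insert_subset hX fun h hh => ?_
      by_cases hle : h ≤ X
      · exact h1.1 (Finset.mem_coe.2 (Finset.mem_filter.2 ⟨hh, hle⟩))
      · exact (h2 (Finset.mem_coe.2 (Finset.mem_filter.2 ⟨hh, hle⟩))).1
    · have hBle : ∀ b ∈ B, b ≤ B.sup id := fun b hb => Finset.le_sup (f := id) hb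
      by_cases hgX : B.sup id ≤ X
      · by_cases hXB : X ∈ B
        · rwa [le_antisymm hgX (hBle X hXB)]
        · exact h1.2 B (fun b hb => Finset.mem_filter.2
            ⟨Finset.mem_of_mem_insert_of_ne (hB hb) (fun e => hXB (e ▸ hb)),
              (hBle b hb).trans hgX⟩) hne hG
      -- The elements of `B` below `X` do not affect the join with `X`, so nestedness in the
      -- contraction yields `b ∈ B₁` with `X ⊔ b = X ⊔ B.sup id`; compatibility then gives `B.sup id
      -- ≤ b`.
      · set B₁ := B.filter (fun h => ¬ h ≤ X) with hB₁
        have hne₁ : B₁.Nonempty := by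
          by_contra hemp
          refine hgX (Finset.sup_le fun b hb => ?_)
          by_contra hbX
          exact hemp ⟨b, Finset.mem_filter.2 ⟨hb, hbX⟩⟩
        have hsub : B₁ ⊆ S.filter (fun h => ¬ h ≤ X) := by
          intro b hb
          obtain ⟨hb, hbX⟩ := Finset.mem_filter.1 hb
          exact Finset.mem_filter.2
            ⟨Finset.mem_of_mem_insert_of_ne (hB hb) (fun e => hbX e.le), hbX⟩
        have hsup : X ⊔ B₁.sup id = X ⊔ B.sup id := by
          refine le_antisymm (sup_le_sup_left (Finset.sup_mono (Finset.filter_subset _ _)) X)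
            (sup_le le_sup_left (Finset.sup_le fun b hb => ?_))
          by_cases hbX : b ≤ X
          · exact le_sup_of_le_left hbX
          · exact le_sup_of_le_right
              (Finset.le_sup (f := id) (Finset.mem_filter.2 ⟨hb, hbX⟩))
        have := h3.2 (B₁.image (X ⊔ ·)) (Finset.image_subset_image hsub) (hne₁.image _)
          (by rw [sup_image_sup X hne₁, hsup]; exact ⟨_, hG, hgX, rfl⟩)
        rw [sup_image_sup X hne₁, hsup] at this
        obtain ⟨b, hb, e⟩ := Finset.mem_image.1 this
        have hle := D.le_of_mem_compatible hX (h2 (Finset.mem_coe.2 (hsub hb))) hG hgX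
          (e ▸ le_sup_right)
        have hbB := (Finset.mem_filter.1 hb).1
        rwa [le_antisymm hle (hBle b hbB)]

/-- Links at the intermediate stages of the shedding. -/
theorem faceLink_eq [Finite L] [DecidableEq L] (D : BuiltMinor r M o G φ (n + 1)) {X X' : L}
    [DecidablePred (· ≤ X)] (hX : X ∈ G) (hXg : X ∉ generated M φ n)
    (hX' : IsGreatest (generated M φ n ∩ Set.Iic X) X') {T : Finset L}
    (hT : ∀ y ∈ T, y ∈ G ∧ y ∉ generated M φ n) (hXT : X ∉ T)
    (hbelow : ∀ y ∈ G, y ∉ generated M φ n → y < X → y ∈ T) (habove : ∀ y ∈ T, ¬ X < y) :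
    faceLink {S | S ∈ nestedFamily G ∧ Disjoint S T} X =
      {S | S.filter (· ≤ X) ∈ nestedFamily (G ∩ generated M φ n ∩ Set.Iic X') ∧
        S.filter (fun h => ¬ h ≤ X) ∈ {R : Finset L | (R : Set L) ⊆ compatible G X ∧
          R.image (X ⊔ ·) ∈ nestedFamily (contraction G X)}} := by
  have hgen : SupClosed (generated M φ n) := supClosed_generated D.supClosed φ n
  have hcl : SupClosed (Set.Iic X') := fun a ha b hb => sup_le ha hb
  ext S
  simp only [faceLink, Set.mem_ofPred_eq, mem_nestedFamily_inter hgen, mem_nestedFamily_inter hcl,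
    Finset.disjoint_insert_left]
  constructor
  · rintro ⟨hXS, hS, -, hST⟩
    obtain ⟨h1, h2⟩ := (D.insert_mem_nestedFamily_iff hX).1 hS
    have hsub : ∀ h ∈ S.filter (· ≤ X), h ∈ generated M φ n := by
      intro h hh
      by_contra hhg
      obtain ⟨hhS, hhX⟩ := Finset.mem_filter.1 hh
      refine Finset.disjoint_left.1 hST hhS (hbelow h (h1.1 hh) hhg (lt_of_le_of_ne hhX ?_))
      rintro rfl
      exact hXS hhS
    exact ⟨⟨⟨h1, hsub⟩, fun h hh => hX'.2 ⟨hsub h hh, (Finset.mem_filter.1 hh).2⟩⟩, h2⟩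
  · rintro ⟨⟨⟨h1, h2⟩, h3⟩, h4⟩
    have hXS : X ∉ S := fun hXS => hXg (h2 (Finset.mem_coe.2 (Finset.mem_filter.2 ⟨hXS, le_rfl⟩)))
    refine ⟨hXS, (D.insert_mem_nestedFamily_iff hX).2 ⟨h1, h4⟩, hXT,
      Finset.disjoint_left.2 fun h hhS hhT => ?_⟩
    by_cases hhX : h ≤ X
    · exact (hT h hhT).2 (h2 (Finset.mem_coe.2 (Finset.mem_filter.2 ⟨hhS, hhX⟩)))
    · rcases (h4.1 (Finset.mem_coe.2 (Finset.mem_filter.2 ⟨hhS, hhX⟩))).2.2 with hle | hsup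
      · exact habove h hhT (lt_of_le_of_ne hle (by rintro rfl; exact hhX le_rfl))
      -- Both `h` and `X` lie above the last generator, so `h ⊔ X ∈ G`, contrary to compatibility.
      · have hlast : ∀ y ∈ G, y ∉ generated M φ n → φ n ≤ y ∧ φ n ∈ G := by
          intro y hy hyg
          obtain ⟨y', hy'⟩ := D.exists_isGreatest_generated n (D.subset hy)
          obtain ⟨-, k1, k2⟩ := D.rank_of_notMem_generated (D.subset hy) hyg hy'
          exact ⟨k1, D.gen_mem_of_not_le (Nat.lt_succ_self n) hy'.1.1.1 (D.subset hy) k1 k2⟩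
        exact hsup (D.sup_mem_of_common_le (hlast X hX hXg).2 (hT h hhT).1 hX
          (hlast h (hT h hhT).1 (hT h hhT).2).1 (hlast X hX hXg).1)

/-- Maximal elements of `G` are kept as vertices so that facets have cardinality `r t - r o`, which
adds up over joins. -/
theorem pureVD_nestedFamily [Finite L] [DecidableEq L] (hr : Monotone r) (n : ℕ) :
    ∀ {M : Set L} {o : L} {G : Set L} {φ : ℕ → L} (_ : BuiltMinor r M o G φ n) {t : L}
      (_ : IsGreatest M t) {d : ℕ} (_ : r t = r o + d), PureVD d (nestedFamily G) := by
  classical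
  induction n with
  | zero =>
    intro M o G φ D t ht d hd
    have hM : ∀ x ∈ M, x = o := by
      intro x hx
      by_contra hne
      obtain ⟨i, hi, -⟩ := D.step o D.bot_mem x hx (lt_of_le_of_ne (D.bot_le x hx) (Ne.symm hne))
      exact Nat.not_lt_zero i hi
    obtain rfl : d = 0 := by rw [hM t ht.1] at hd; omega
    suffices h : nestedFamily G = {S | S ⊆ ∅} from h ▸ PureVD.simplex ∅
    ext S
    simp only [Set.mem_ofPred_eq, Finset.subset_empty]
    constructor
    · refine fun hS => Finset.eq_empty_of_forall_notMem fun x hx => ?_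
      have hxG := hS.1 hx
      exact D.bot_notMem (hM x (D.subset hxG) ▸ hxG)
    · rintro rfl
      exact ⟨by simp, fun B hB hne => absurd hne (by simp [Finset.subset_empty.1 hB])⟩
  | succ n ih =>
    intro M o G φ D t ht d hd
    have hgen : SupClosed (generated M φ n) := supClosed_generated D.supClosed φ n
    -- `E` is a lower set among the elements of `G` that are not generated, so everything of this
    -- kind below `X` is gone when `X` is shed.
    have shed : ∀ E : Finset L, (∀ x ∈ E, x ∈ G ∧ x ∉ generated M φ n) →
        (∀ x ∈ E, ∀ y ∈ G, y ∉ generated M φ n → y < x → y ∈ E) →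
        PureVD d {S | S ∈ nestedFamily G ∧ Disjoint S E} → PureVD d (nestedFamily G) := by
      intro E hE hlow hVD
      refine PureVD.of_shedding hVD fun T hT X hXE hXT hbelow habove => ?_
      obtain ⟨hX, hXg⟩ := hE X hXE
      have hXM := D.subset hX
      obtain ⟨X', hX'⟩ := D.exists_isGreatest_generated n hXM
      obtain ⟨hrX, heX, -⟩ := D.rank_of_notMem_generated hXM hXg hX'
      obtain ⟨d₁, hd₁⟩ := Nat.exists_eq_add_of_le (hr (D.bot_le X' hX'.1.1.1))
      obtain ⟨d₂, hd₂⟩ := Nat.exists_eq_add_of_le (hr (ht.2 hXM))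
      refine ⟨d₁ + d₂, by omega, ?_⟩
      rw [D.faceLink_eq hX hXg hX' (fun y hy => hE y (hT hy)) hXT
        (fun y hy hyg hyX => hbelow y (hlow X hXE y hy hyg hyX) hyX) habove]
      have h₁ := ih (D.delete.restrict hX'.1.1) ⟨⟨hX'.1.1, le_rfl⟩, fun _ h => h.2⟩ hd₁
      -- Since `φ n ≤ X`, the last generator becomes trivial over `X`.
      have h₂ := ih ((D.contract hX).drop_last (sup_le le_rfl heX))
        ⟨⟨ht.1, ht.2 hXM⟩, fun _ h => ht.2 h.1⟩ hd₂
      have h₃ := h₂.comap (D.injOn_compatible hX) fun S hS v hv =>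
        contraction_subset_image G X (hS.1 hv)
      exact h₁.join h₃ (fun S hS v hv => le_trans (hS.1 hv).2 hX'.1.2)
        (fun S hS v hv => (hS.1 hv).2.1)
    by_cases htg : t ∈ generated M φ n
    · refine shed (Set.toFinite {x | x ∈ G ∧ x ∉ generated M φ n}).toFinset
        (fun x hx => by simpa using hx) (fun x _ y hy hyg _ => by simpa using ⟨hy, hyg⟩) ?_
      convert ih D.delete ⟨htg, fun x hx => ht.2 hx.1⟩ hd using 1
      ext S
      simp only [Set.mem_ofPred_eq, mem_nestedFamily_inter hgen, Finset.disjoint_left,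
        Set.Finite.mem_toFinset]
      refine and_congr_right fun hS => ⟨fun h x hx => ?_, fun h x hx hx' => hx'.2 (h hx)⟩
      by_contra hxg
      exact h hx ⟨hS.1 hx, hxg⟩
    · obtain ⟨t', ht'⟩ := D.exists_isGreatest_generated n ht.1
      obtain ⟨hrt, het, het'⟩ := D.rank_of_notMem_generated ht.1 htg ht'
      have heG := D.gen_mem_of_not_le (Nat.lt_succ_self n) ht'.1.1.1 ht.1 het het'
      have hiff : ∀ x ∈ G, (x ∉ generated M φ n ↔ φ n ≤ x) := by
        intro x hx
        refine ⟨fun hxg => ?_, fun hex hxg =>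
          het' (hex.trans (ht'.2 ⟨hxg, ht.2 (D.subset hx)⟩))⟩
        obtain ⟨x', hx'⟩ := D.exists_isGreatest_generated n (D.subset hx)
        exact (D.rank_of_notMem_generated (D.subset hx) hxg hx').2.1
      -- The elements of `G` above `φ n` are closed under joins. Their greatest element `m` is not
      -- shed: it becomes the apex of a cone over the generated part, making up for the rank lost
      -- from `t` to `t'`.
      obtain ⟨m, hm, hmax⟩ := exists_isGreatest_of_supClosed (N := {x | x ∈ G ∧ φ n ≤ x})
        (fun a ha b hb => ⟨D.sup_mem_of_common_le heG ha.1 hb.1 ha.2 hb.2, le_sup_of_le_left ha.2⟩)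
        ⟨φ n, heG, le_rfl⟩
      obtain ⟨d', hd'⟩ := Nat.exists_eq_add_of_le (hr (D.bot_le t' ht'.1.1.1))
      obtain rfl : d = d' + 1 := by omega
      have hcone := (ih D.delete ⟨ht'.1.1, fun x hx => ht'.2 ⟨hx, ht.2 hx.1⟩⟩ hd').cone (v := m)
        fun S hS hmS => (hiff m hm.1).2 hm.2 (hS.1 hmS).2
      refine shed (Set.toFinite {x | x ∈ G ∧ x ∉ generated M φ n ∧ x ≠ m}).toFinset
        (fun x hx => ?_) (fun x hx y hy hyg hyx => ?_) ?_
      · rw [Set.Finite.mem_toFinset] at hx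
        exact ⟨hx.1, hx.2.1⟩
      · rw [Set.Finite.mem_toFinset] at hx ⊢
        refine ⟨hy, hyg, ?_⟩
        rintro rfl
        exact hyx.not_ge (hmax ⟨hx.1, (hiff x hx.1).1 hx.2.1⟩)
      · convert hcone using 1
        ext S
        simp only [Set.mem_ofPred_eq, mem_nestedFamily_inter hgen, Finset.disjoint_left,
          Set.Finite.mem_toFinset]
        constructor
        · rintro ⟨hS, h⟩
          refine ⟨mem_nestedFamily_of_subset hS (Finset.erase_subset m S), fun x hx => ?_⟩
          by_contra hxg
          obtain ⟨hxm, hxS⟩ := Finset.mem_erase.1 (Finset.mem_coe.1 hx)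
          exact h hxS ⟨hS.1 hxS, hxg, hxm⟩
        · rintro ⟨hS, h⟩
          constructor
          · have := insert_mem_nestedFamily hS hm.1 fun x hx hmx =>
              le_antisymm (hmax ⟨hx, hm.2.trans hmx⟩) hmx
            refine mem_nestedFamily_of_subset this fun x hx => ?_
            by_cases hxm : x = m
            · rw [hxm]; exact Finset.mem_insert_self m _
            · exact Finset.mem_insert_of_mem (Finset.mem_erase.2 ⟨hxm, hx⟩)
          · intro x hxS hx
            exact hx.2.1 (h (Finset.mem_coe.2 (Finset.mem_erase.2 ⟨hx.2.2, hxS⟩)))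

end BuiltMinor

end Nested

/-! ### Building sets and admissible maps -/

section Lattice

variable {L : Type*} [Lattice L] [BoundedOrder L]

/-- A finite set has the same join as the antichain of its maximal elements. The form with arbitrary
subsets avoids tracking antichains under `X ⊔ ·`. -/
theorem mem_nestedFamily_iff [Finite L] {G : Set L} {S : Finset L} :
    S ∈ nestedFamily G ↔ IsNested G S := by
  refine and_congr_right fun _ => ⟨fun h A hA hanti hcard hG => ?_, fun h B hB hne hG => ?_⟩
  · have hmem := h A hA (Finset.card_pos.1 (by omega)) hG
    obtain ⟨b, hb, hbne⟩ := Finset.exists_mem_ne (by omega : 1 < A.card) (A.sup id)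
    exact hanti hb hmem hbne (Finset.le_sup (f := id) hb)
  · classical
    set A := B.filter (fun x => Maximal (· ∈ B) x) with hA
    have hAB : A ⊆ B := Finset.filter_subset _ B
    have hsup : A.sup id = B.sup id := by
      refine le_antisymm (Finset.sup_mono hAB) (Finset.sup_le fun b hb => ?_)
      obtain ⟨m, hbm, hm⟩ := B.exists_le_maximal hb
      exact hbm.trans (Finset.le_sup (f := id) (Finset.mem_filter.2 ⟨hm.prop, hm⟩))
    have hanti : IsAntichain (· ≤ ·) (A : Set L) := fun x hx y hy hxy hle =>
      hxy ((Finset.mem_filter.1 hx).2.eq_of_le (hAB hy) hle)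
    have hcard : A.card < 2 := by
      by_contra hc
      exact h A (hAB.trans hB) hanti (by omega) (hsup ▸ hG)
    have hneA : A.Nonempty := by
      obtain ⟨b, hb⟩ := hne
      obtain ⟨m, -, hm⟩ := B.exists_le_maximal hb
      exact ⟨m, Finset.mem_filter.2 ⟨hm.prop, hm⟩⟩
    have hc1 : A.card = 1 := by have := hneA.card_pos; omega
    obtain ⟨a, ha⟩ := Finset.card_eq_one.1 hc1
    rw [ha, Finset.sup_singleton, id] at hsup
    rw [← hsup]
    exact hAB (ha ▸ Finset.mem_singleton_self a)

/-- An element outside a building set splits off any of its factors. -/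
theorem IsBuildingSet.exists_splits [Finite L] {G : Set L} (hG : IsBuildingSet G) {F : L}
    (hF : F ≠ ⊥) (hFG : F ∉ G) : ∃ y z, Splits Set.univ G F y z := by
  classical
  obtain ⟨ψ, hψ⟩ := hG.2 F
  have hle : ∀ (H : (g : factors G F) → Set.Iic (g : L)) g, (H g : L) ≤ ψ H :=
    fun H g => (hψ H).1 ⟨g, rfl⟩
  have hψtop : (ψ ⊤ : L) = F := by rw [map_top]; rfl
  have hψbot : (ψ ⊥ : L) = ⊥ := by rw [map_bot]; rfl
  have hne : Nonempty (factors G F) := by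
    by_contra hemp
    rw [not_nonempty_iff] at hemp
    refine hF ?_
    rw [← hψtop, ← hψbot, Subsingleton.elim (⊤ : (g : factors G F) → Set.Iic (g : L)) ⊥]
  obtain ⟨g₀⟩ := hne
  have hg₀ : (g₀ : L) ∈ G ∧ (g₀ : L) ≤ F := Maximal.prop (P := fun x => x ∈ G ∧ x ≤ F) g₀.2
  -- `ψ K` is the join of the factors other than `g₀`; it serves as the complementary factor.
  let K : (g : factors G F) → Set.Iic (g : L) := Function.update ⊤ g₀ ⊥
  have hKne : ∀ g, g ≠ g₀ → K g = ⊤ := fun g hg => Function.update_of_ne hg _ _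
  have hK₀ : K g₀ = ⊥ := Function.update_self _ _ _
  have decomp : ∀ u ≤ (g₀ : L), ∀ w ≤ (ψ K : L),
      ∃ H, (ψ H : L) = u ⊔ w ∧ (H g₀ : L) = u ∧ (ψ (Function.update H g₀ ⊥) : L) = w := by
    intro u hu w hw
    obtain ⟨H, hH⟩ := ψ.surjective ⟨w, hw.trans (ψ K).2⟩
    have hHw : (ψ H : L) = w := by rw [hH]
    have hHK : H ≤ K := ψ.le_iff_le.1 (by rw [hH]; exact hw)
    have hH₀ : H g₀ = ⊥ := le_bot_iff.1 (hK₀ ▸ hHK g₀)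
    refine ⟨Function.update H g₀ ⟨u, hu⟩, ?_, by simp, ?_⟩
    · have hlub := hψ (Function.update H g₀ ⟨u, hu⟩)
      refine le_antisymm (hlub.2 ?_) (sup_le ?_ ?_)
      · rintro _ ⟨g, rfl⟩
        by_cases hg : g = g₀
        · subst hg
          simp
        · simp only [Function.update_of_ne hg]
          exact le_sup_of_le_right (hHw ▸ hle H g)
      · exact (by simp : u = (Function.update H g₀ ⟨u, hu⟩ g₀ : L)).trans_le (hle _ g₀)
      · rw [← hHw]
        refine ψ.monotone (le_update_iff.2 ⟨?_, fun _ _ => le_rfl⟩)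
        rw [hH₀]
        exact bot_le
    · rw [Function.update_idem, ← hH₀, Function.update_eq_self, hHw]
  have hsup : (g₀ : L) ⊔ ψ K = F := by
    refine le_antisymm (sup_le hg₀.2 (ψ K).2) (hψtop.symm.le.trans ((hψ ⊤).2 ?_))
    rintro _ ⟨g, rfl⟩
    by_cases hg : g = g₀
    · subst hg
      exact le_sup_left
    · refine le_sup_of_le_right (le_trans (le_of_eq ?_) (hle K g))
      rw [hKne g hg]
      rfl
  refine ⟨g₀, ψ K, Set.mem_univ _, Set.mem_univ _, fun e => hFG (e ▸ hg₀.1), fun e => ?_, hsup,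
    fun g hg hgF => ?_, fun u _ v _ w _ t _ hu hv hw ht h => ?_⟩
  · have hKtop : K = ⊤ := ψ.injective (Subtype.ext (e.trans hψtop.symm))
    have : (⊥ : Set.Iic (g₀ : L)) = ⊤ := by rw [← hK₀, hKtop]; rfl
    have h0 : (⊥ : L) = g₀ := congrArg Subtype.val this
    exact hG.1 (h0 ▸ hg₀.1)
  · obtain ⟨m, hgm, hm⟩ := (Set.toFinite {x | x ∈ G ∧ x ≤ F}).exists_le_maximal
      (show g ∈ {x | x ∈ G ∧ x ≤ F} from ⟨hg, hgF⟩)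
    by_cases e : (⟨m, hm⟩ : factors G F) = g₀
    · exact Or.inl (e ▸ hgm)
    · refine Or.inr (hgm.trans (le_trans (le_of_eq ?_) (hle K ⟨m, hm⟩)))
      rw [hKne _ e]
      rfl
  · obtain ⟨H, h1, h2, h3⟩ := decomp u hu w hw
    obtain ⟨H', h1', h2', h3'⟩ := decomp v hv t ht
    have hHH : H ≤ H' := ψ.le_iff_le.1 (by
      rw [← Subtype.coe_le_coe, h1, h1']
      exact h)
    refine ⟨?_, ?_⟩
    · rw [← h2, ← h2']
      exact hHH g₀
    · rw [← h3, ← h3']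
      exact ψ.monotone (update_le_update_iff.2 ⟨le_rfl, fun g _ => hHH g⟩)

/-- On a saturated chain with increasing labels starting from `l`, an element below the top and not
below the bottom enters at a step whose label is at least `l`. -/
theorem exists_covBy_of_isChain {L : Type*} [PartialOrder L] {lam : L → L → ℕ} {x : L} :
    ∀ {c : List L} {a b : L} {l : ℕ}, (a :: c).getLast? = some b → (a :: c).IsChain (· ⋖ ·) →
      (l :: chainLabels lam (a :: c)).IsChain (· ≤ ·) → x ≤ b → ¬ x ≤ a →
      ∃ u v, u ⋖ v ∧ ¬ x ≤ u ∧ x ≤ v ∧ l ≤ lam u v := by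
  intro c
  induction c with
  | nil =>
    intro a b l hb _ _ hxb hxa
    simp only [List.getLast?_singleton, Option.some.injEq] at hb
    exact absurd (hb ▸ hxb) hxa
  | cons d c ih =>
    intro a b l hb hc hl hxb hxa
    rw [List.isChain_cons_cons] at hc
    simp only [chainLabels, List.tail_cons, List.zipWith_cons_cons, List.isChain_cons_cons] at hl
    by_cases hxd : x ≤ d
    · exact ⟨a, d, hc.1, hxa, hxd, hl.1⟩
    · obtain ⟨u, v, h1, h2, h3, h4⟩ := ih (l := lam a d) (by rwa [List.getLast?_cons_cons] at hb)
        hc.2 hl.2 hxb hxd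
      exact ⟨u, v, h1, h2, h3, hl.1.trans h4⟩

/-- For `a < b` the join-irreducible element of least label among those below `b` and not below
`a` produces a cover of `a`. -/
theorem IsAdmissible.exists_covBy [Finite L] {ω : {x : L // SupIrred x} → ℕ+}
    (hω : IsAdmissible ω) {a b : L} (hab : a < b) :
    ∃ I : {x : L // SupIrred x}, (I : L) ≤ b ∧ ¬ (I : L) ≤ a ∧ a ⋖ a ⊔ (I : L) ∧
      ∀ J, ω J < ω I → (J : L) ≤ b → (J : L) ≤ a := by
  obtain ⟨c, ⟨⟨hhead, hlast, hchain⟩, hlab⟩, -⟩ := hω a b hab.le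
  obtain _ | ⟨a', _ | ⟨d, c⟩⟩ := c
  · simp at hhead
  · simp only [List.head?_cons, Option.some.injEq, List.getLast?_singleton] at hhead hlast
    exact absurd (hhead.symm.trans hlast) hab.ne
  · simp only [List.head?_cons, Option.some.injEq] at hhead
    subst hhead
    obtain ⟨had, hchain'⟩ := List.isChain_cons_cons.1 hchain
    -- `I` realizes the first label of the increasing chain. Any `J` below `b` and not below `a`
    -- enters at some step, whose label is at most `ω J` and at least that first label.
    obtain ⟨I, hId, hI⟩ := exists_edgeLabel_eq ω had
    have hlast' : (d :: c).getLast? = some b := by rwa [List.getLast?_cons_cons] at hlast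
    have hdb : d ≤ b := by
      rcases List.mem_cons.1 (List.mem_of_getLast? hlast') with rfl | hbc
      · exact le_rfl
      · exact (hchain'.imp fun _ _ h => h.le).rel_cons hbc
    have hIa : ¬ (I : L) ≤ a' := fun h => had.lt.ne (by rw [← hId, sup_eq_left.2 h])
    refine ⟨I, (hId ▸ le_sup_right : (I : L) ≤ d).trans hdb, hIa, by rwa [hId], fun J hJ hJb => ?_⟩
    by_contra hJa
    have hbound : ∀ u v, u ⋖ v → ¬ (J : L) ≤ u → (J : L) ≤ v → edgeLabel ω u v ≤ (ω J : ℕ) := by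
      intro u v huv hu hv
      refine Nat.sInf_le ⟨J, ?_, rfl⟩
      exact (huv.eq_or_eq le_sup_left (sup_le huv.le hv)).resolve_left
        fun e => hu (sup_eq_left.1 e)
    have hJI : (ω J : ℕ) < ω I := hJ
    by_cases hJd : (J : L) ≤ d
    · have := hbound a' d had hJa hJd
      omega
    · obtain ⟨u, v, huv, hu, hv, h⟩ := exists_covBy_of_isChain (lam := edgeLabel ω)
        (l := edgeLabel ω a' d) hlast' hchain' hlab hJb hJd
      have := hbound u v huv hu hv
      omega

/-- Injectivity lets the labels themselves index the generators, with `⊥` at unused numbers.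
Join-irreducibles lie in `G`, since an element `≠ ⊥` outside `G` is the join of two proper factors.
-/
theorem builtMinor_univ [Finite L] [GradeMinOrder ℕ L] {G : Set L} (hG : IsBuildingSet G)
    {ω : {x : L // SupIrred x} → ℕ+} (hω : IsAdmissible ω) (hinj : Function.Injective ω) :
    ∃ φ n, BuiltMinor (grade ℕ : L → ℕ) Set.univ ⊥ G φ n := by
  classical
  let φ : ℕ → L := fun i => if h : ∃ I, (ω I : ℕ) = i then (h.choose : L) else ⊥
  have hφ : ∀ I, φ (ω I) = I := by
    intro I
    have h : ∃ J, (ω J : ℕ) = ω I := ⟨I, rfl⟩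
    have hJ : h.choose = I := hinj (PNat.coe_injective h.choose_spec)
    simp only [φ, dif_pos h, hJ]
  have hφ' : ∀ i, φ i = ⊥ ∨ ∃ I, (ω I : ℕ) = i ∧ φ i = I := by
    intro i
    by_cases h : ∃ I, (ω I : ℕ) = i
    · obtain ⟨I, rfl⟩ := h
      exact Or.inr ⟨I, rfl, hφ I⟩
    · exact Or.inl (dif_neg h)
  have hirr : ∀ x : L, SupIrred x → x ∈ G := by
    intro x hx
    by_contra hxG
    obtain ⟨y, z, h⟩ := hG.exists_splits hx.ne_bot hxG
    exact (hx.2 h.sup_eq).elim h.left_ne h.right_ne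
  obtain ⟨n, hn⟩ : ∃ n, ∀ I, (ω I : ℕ) < n := by
    obtain ⟨n, hn⟩ := (Set.finite_range fun I => (ω I : ℕ)).bddAbove
    exact ⟨n + 1, fun I => Nat.lt_succ_of_le (hn ⟨I, rfl⟩)⟩
  refine ⟨φ, n, Set.mem_univ _, fun _ _ => bot_le, fun _ _ _ _ => Set.mem_univ _,
    Set.subset_univ G, hG.1, fun i _ _ _ _ => ?_, fun a _ b _ hab => ?_,
    fun F _ hF hFG => hG.exists_splits hF hFG⟩
  · rcases hφ' i with h | ⟨I, -, h⟩
    · exact Or.inl h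
    · exact Or.inr (h ▸ hirr I I.2)
  · obtain ⟨I, h1, h2, h3, h4⟩ := hω.exists_covBy hab
    refine ⟨ω I, hn I, by rwa [hφ], by rwa [hφ], ?_, fun j hj hjb => ?_⟩
    · rw [hφ]
      exact (Nat.covBy_iff_add_one_eq.1 (h3.grade ℕ)).symm
    · rcases hφ' j with h | ⟨J, rfl, h⟩
      · exact h ▸ bot_le
      · rw [h] at hjb ⊢
        exact h4 J hj hjb

end Lattice

end NestedSets

/-- If a finite graded lattice `L` admits an injective admissible map, then for every building set
`G` of `L` the nested set complex `N(L, G)` is vertex decomposable. -/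
theorem theoremA {L : Type*} [Lattice L] [BoundedOrder L] [Finite L] [GradeMinOrder ℕ L]
    (G : Set L) (hG : NestedSets.IsBuildingSet G)
    (hω : ∃ ω : {x : L // SupIrred x} → ℕ+,
      Function.Injective ω ∧ NestedSets.IsAdmissible ω) :
    (NestedSets.nestedSetComplex G).VertexDecomposable := by
  classical
  obtain ⟨ω, hinj, hadm⟩ := hω
  obtain ⟨φ, n, D⟩ := NestedSets.builtMinor_univ hG hadm hinj
  obtain ⟨d, hd⟩ := Nat.exists_eq_add_of_le (grade_mono (𝕆 := ℕ) (bot_le : (⊥ : L) ≤ ⊤))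
  have hfull := D.pureVD_nestedFamily grade_mono n
    (show IsGreatest Set.univ (⊤ : L) from ⟨Set.mem_univ _, fun _ _ => le_top⟩) hd
  -- The nested set complex excludes the maximal elements of `G`, all of which are apexes of the
  -- full family.
  obtain ⟨d', h⟩ := hfull.remove_apexes
    (fun S hS T hT => NestedSets.mem_nestedFamily_of_subset hS hT)
    (Set.toFinite {g | Maximal (· ∈ G) g}).toFinset fun g hg S hS => by
      rw [Set.Finite.mem_toFinset] at hg
      exact NestedSets.insert_mem_nestedFamily hS hg.prop fun x hx hgx => (hg.eq_of_le hx hgx).symm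
  refine h.vertexDecomposable _ fun S => ?_
  change S.Nonempty ∧ NestedSets.IsNested G S ∧ _ ↔ _
  simp only [Set.mem_ofPred_eq, NestedSets.mem_nestedFamily_iff, Finset.disjoint_left,
    Set.Finite.mem_toFinset]
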